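/- **Theorem 4.7.** Let $X$ be a real reflexive Banach space, let $K\subseteq X$ be a nonempty, convex, closed set, and let $D\subseteq K$ be self segment-dense in $K$ with respect to the weak topology of $X$; that is, $D$ is weakly dense in $K$ and for all $x,y\in D$ the set $[x,y]\cap D$ is weakly dense in the closed segment $[x,y]=\{x+t(y-x): t\in[0,1]\}$. Let $\varphi:K\times K\to\mathbb{R}$ be a function such that: (i) for every $y\in D$ the function $x\mapsto\varphi(x,y)$ is weakly upper semicontinuous on $K$; (ii) for every $x\in K$ the function $y\mapsto\varphi(x,y)$, $y\in K$, is weakly upper semicontinuous at every point of $K\setminus D$; (iii) for every $x\in K$ the function $y\mapsto\varphi(x,y)$ is convex on $D$, that is, $\varphi\big(x,\sum_{i=1}^n\lambda_i y_i\big)\le\sum_{i=1}^n\lambda_i\varphi(x,y_i)$ whenever $n\ge 1$, $y_1,\dots,y_n\in D$, $\lambda_1,\dots,\lambda_n\ge 0$, $\sum_{i=1}^n\lambda_i=1$ and $\sum_{i=1}^n\lambda_iy_i\in D$; (iv) $\varphi(x,x)\ge 0$ for every $x\in D$; (v) there is $r>0$ such that $K\cap\{x\in X:\|x\|\le r\}\neq\emptyset$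 and for every $x\in K$ with $\|x\|\le r$ there exists $y_0\in D$ with $\|y_0\|<r$ and $\varphi(x,y_0)=0$. Then there exists $x_0\in K$ such that $\varphi(x_0,y)\ge 0$ for all $y\in K$. -/

import Mathlib

/-- A real normed space is reflexive if the canonical isometric embedding into its
topological double dual is surjective. -/
def IsReflexiveSpace (X : Type*) [NormedAddCommGroup X] [NormedSpace ℝ X] : Prop :=
  Function.Surjective (NormedSpace.inclusionInDoubleDual ℝ X)

/-- `U` is self segment-dense in the (convex) set `V`: `U ⊆ V`, `U` is dense in `V`, and for all
`x, y ∈ U` the set `[x, y] ∩ U` is dense in the closed segment `[x, y]`. -/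
def SelfSegmentDense {E : Type*} [AddCommGroup E] [Module ℝ E] [TopologicalSpace E]
    (U V : Set E) : Prop :=
  U ⊆ V ∧ V ⊆ closure U ∧
    ∀ x ∈ U, ∀ y ∈ U, segment ℝ x y ⊆ closure (segment ℝ x y ∩ U)

/-- `U` is self segment-dense in `V` with respect to the weak topology of `X`. -/
def WeaklySelfSegmentDense {X : Type*} [NormedAddCommGroup X] [NormedSpace ℝ X]
    (U V : Set X) : Prop :=
  SelfSegmentDense (toWeakSpace ℝ X '' U) (toWeakSpace ℝ X '' V)

/-- The function `f`, regarded as a function on the set `S` with the topology induced by the weak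
topology of `X`, is upper semicontinuous at the point `x`. -/
def WeaklyUSCWithinAt {X : Type*} [NormedAddCommGroup X] [NormedSpace ℝ X]
    (f : X → ℝ) (S : Set X) (x : X) : Prop :=
  UpperSemicontinuousWithinAt (fun z : WeakSpace ℝ X => f ((toWeakSpace ℝ X).symm z))
    (toWeakSpace ℝ X '' S) (toWeakSpace ℝ X x)

/-- Convexity of a real function on a set `S` that need not be convex: Jensen's inequality holds
for every finite convex combination of points of `S` that lies in `S`. -/
def ConvexOnArbitrary {E : Type*} [AddCommGroup E] [Module ℝ E] (S : Set E) (f : E → ℝ) : Prop :=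
  ∀ (n : ℕ) (w : Fin n → ℝ) (z : Fin n → E), (∀ i, 0 ≤ w i) → ∑ i, w i = 1 →
    (∀ i, z i ∈ S) → ∑ i, w i • z i ∈ S → f (∑ i, w i • z i) ≤ ∑ i, w i * f (z i)

/-! In the weak topology, `K ∩ closedBall 0 r` is convex and, by reflexivity, compact. A Ky Fan
argument (`SelfSegmentDense.exists_forall_inter_nonneg`) yields a point x of it with φ(x, y) ≥ 0 for
every y ∈ D in the ball. Condition (v) supplies y₀ ∈ D in the open ball with φ(x, y₀) = 0. Convexity
at a point of D on [y₀, y] close to y₀ then gives φ(x, y) ≥ 0 for every y ∈ D, and (ii) with weak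
density extends this to K.

The Ky Fan step is KKM plus compactness. Since D need not be convex, the KKM covering cannot be
checked directly at points of a hull. If it fails at one, the strict inequalities persist nearby by
upper semicontinuity, and `SelfSegmentDense.convexHull_subset_closure` moves the point into D within
the same hull, where convexity contradicts φ(x, x) ≥ 0.

KKM itself is derived without triangulations: Scarf's lemma, a parity count of dominant sets, is
applied to lattice points of dilated simplices, and a limit is taken. -/

/-- A finite set `S` is dominant for the family of rankings `r` if no point lies strictly above
the minimum of `S` in all rankings simultaneously. -/
def IsDominant {ι W : Type*} (r : ι → W → ℕ) (S : Finset W) : Prop :=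
  ∀ y, ∃ i, ∀ x ∈ S, r i y ≤ r i x

/-! ### Combinatorics: Scarf's lemma by a door-and-room parity count. -/

section Scarf

open Finset

variable {ι W : Type*} {r : ι → W → ℕ}

theorem IsDominant.mono {S T : Finset W} (h : IsDominant r S) (hT : T ⊆ S) : IsDominant r T :=
  fun y => (h y).imp fun _ hi x hx => hi x (hT hx)

/-- `x` is the `r l`-greatest point among those exceeding the thresholds `a k`, `k ≠ l`. -/
def IsTopAbove (r : ι → W → ℕ) (a : ι → W) (l : ι) (x : W) : Prop :=
  (∀ k, k ≠ l → r k (a k) < r k x) ∧ ∀ y, (∀ k, k ≠ l → r k (a k) < r k y) → r l y ≤ r l x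

theorem exists_isTopAbove [Finite W] (a : ι → W) (l : ι)
    (h : ∃ y, ∀ k, k ≠ l → r k (a k) < r k y) : ∃ x, IsTopAbove r a l x := by
  obtain ⟨x, hx, hmax⟩ := Set.exists_max_image {y | ∀ k, k ≠ l → r k (a k) < r k y} (r l)
    (Set.toFinite _) h
  exact ⟨x, hx, hmax⟩

theorem IsTopAbove.unique (hr : ∀ i, Function.Injective (r i)) {a : ι → W} {l : ι} {x y : W}
    (hx : IsTopAbove r a l x) (hy : IsTopAbove r a l y) : x = y :=
  hr l (le_antisymm (hy.2 x hx.1) (hx.2 y hy.1))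

variable [Fintype ι] [Fintype W] [DecidableEq ι] [DecidableEq W]

/-- A dominant set with one element less than there are rankings has exactly two dominant
one-point extensions, as long as the relevant threshold regions are nonempty. -/
theorem IsDominant.card_extensions (hr : ∀ i, Function.Injective (r i)) {R : Finset W}
    (hR : IsDominant r R) (hne : R.Nonempty) (hcard : #R + 1 = Fintype.card ι)
    (habove : ∀ l, ∃ y, ∀ k, k ≠ l → ∃ z ∈ R, r k z < r k y) :
    ({x | x ∉ R ∧ IsDominant r (insert x R)} : Set W).ncard = 2 := by
  have hmin : ∀ i, ∃ a ∈ R, ∀ x ∈ R, r i a ≤ r i x := fun i => exists_min_image R (r i) hne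
  choose m hmR hm using hmin
  have hsurj : ∀ z ∈ R, ∃ i, m i = z := by
    intro z hz
    obtain ⟨i, hi⟩ := hR z
    exact ⟨i, hr i (le_antisymm (hm i z hz) (hi _ (hmR i)))⟩
  -- The minimum map `m` is onto `R`, which has one element less than `ι`, so exactly one pair of
  -- rankings shares its minimum.
  obtain ⟨i, -, j, -, hij, hmij⟩ := exists_ne_map_eq_of_card_lt_of_maps_to
    (s := univ) (t := R) (f := m) (by rw [card_univ]; omega) (fun k _ => hmR k)
  have hsurj' : ∀ l, l = i ∨ l = j → ∀ z ∈ R, ∃ k, k ≠ l ∧ m k = z := by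
    intro l hl z hz
    obtain ⟨k, hk⟩ := hsurj z hz
    by_cases hkl : k = l
    · rcases hl with rfl | rfl
      · exact ⟨j, hij.symm, by rw [← hmij, ← hkl, hk]⟩
      · exact ⟨i, hij, by rw [hmij, ← hkl, hk]⟩
    · exact ⟨k, hkl, hk⟩
  have hab : ∀ l, ∃ y, ∀ k, k ≠ l → r k (m k) < r k y := by
    intro l
    obtain ⟨y, hy⟩ := habove l
    refine ⟨y, fun k hk => ?_⟩
    obtain ⟨z, hz, hzy⟩ := hy k hk
    exact (hm k z hz).trans_lt hzy
  have key : {x | x ∉ R ∧ IsDominant r (insert x R)} =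
      {x | IsTopAbove r m i x ∨ IsTopAbove r m j x} := by
    ext x
    simp only [Set.mem_ofPred_eq]
    constructor
    · rintro ⟨hxR, hdom⟩
      obtain ⟨l, hl⟩ := hdom x
      have hlx : ¬ r l (m l) < r l x := not_lt.2 (hl _ (mem_insert_of_mem (hmR l)))
      -- Each `z ∈ R` remains the minimum of some ranking after `x` is added, so `x` lies strictly
      -- above that minimum. Counting then forces `x` above every minimum but the `l`-th and `m`
      -- injective off `l`, hence `l` is `i` or `j`.
      have hA : R ⊆ (univ.filter fun k => r k (m k) < r k x).image m := by
        intro z hz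
        obtain ⟨k, hk⟩ := hdom z
        have hkz : m k = z :=
          hr k (le_antisymm (hm k z hz) (hk _ (mem_insert_of_mem (hmR k))))
        refine mem_image.2 ⟨k, ?_, hkz⟩
        rw [mem_filter, hkz]
        refine ⟨mem_univ _, lt_of_le_of_ne (hk x (mem_insert_self _ _)) fun h => hxR ?_⟩
        rwa [← hr k h]
      have hsub : (univ.filter fun k => r k (m k) < r k x) ⊆ univ.erase l := by
        intro k hk
        refine mem_erase.2 ⟨?_, mem_univ _⟩
        rintro rfl
        exact hlx (mem_filter.1 hk).2
      have hc1 := card_le_card hA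
      have hc2 := card_le_card hsub
      rw [card_erase_of_mem (mem_univ _), card_univ] at hc2
      have hc3 : #((univ.filter fun k => r k (m k) < r k x).image m) ≤
        #(univ.filter fun k => r k (m k) < r k x) := card_image_le
      have heq : (univ.filter fun k => r k (m k) < r k x) = univ.erase l :=
        eq_of_subset_of_card_le hsub (by
          rw [card_erase_of_mem (mem_univ _), card_univ]; omega)
      have hinj : Set.InjOn m (univ.erase l : Finset ι) := by
        rw [← heq]
        exact card_image_iff.1 (by omega)
      have hgt : ∀ k, k ≠ l → r k (m k) < r k x := by
        intro k hk
        have : k ∈ univ.erase l := mem_erase.2 ⟨hk, mem_univ _⟩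
        rw [← heq] at this
        exact (mem_filter.1 this).2
      have htop : IsTopAbove r m l x := by
        refine ⟨hgt, fun y hy => ?_⟩
        obtain ⟨k, hk⟩ := hdom y
        by_cases hkl : k = l
        · subst hkl
          exact hk x (mem_insert_self _ _)
        · exact absurd (hk _ (mem_insert_of_mem (hmR k))) (not_le.2 (hy k hkl))
      by_cases hli : l = i
      · exact Or.inl (hli ▸ htop)
      by_cases hlj : l = j
      · exact Or.inr (hlj ▸ htop)
      exact absurd (hinj (by simpa using Ne.symm hli) (by simpa using Ne.symm hlj) hmij) hij
    · intro h
      obtain ⟨l, hl, htop⟩ : ∃ l, (l = i ∨ l = j) ∧ IsTopAbove r m l x := by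
        rcases h with h | h
        exacts [⟨i, Or.inl rfl, h⟩, ⟨j, Or.inr rfl, h⟩]
      refine ⟨fun hx => ?_, fun y => ?_⟩
      · obtain ⟨k, hk, rfl⟩ := hsurj' l hl x hx
        exact lt_irrefl _ (htop.1 k hk)
      · by_cases hy : ∀ k, k ≠ l → r k (m k) < r k y
        · refine ⟨l, fun z hz => ?_⟩
          rcases mem_insert.1 hz with rfl | hz
          · exact htop.2 y hy
          · obtain ⟨k, hk⟩ := hR y
            by_cases hkl : k = l
            · subst hkl
              exact hk z hz
            · exact absurd (hk _ (hmR k)) (not_le.2 (hy k hkl))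
        · push Not at hy
          obtain ⟨k, hkl, hk⟩ := hy
          refine ⟨k, fun z hz => ?_⟩
          rcases mem_insert.1 hz with rfl | hz
          · exact hk.trans (htop.1 k hkl).le
          · exact hk.trans (hm k z hz)
  obtain ⟨xi, hxi⟩ := exists_isTopAbove m i (hab i)
  obtain ⟨xj, hxj⟩ := exists_isTopAbove m j (hab j)
  -- A common point would exceed the minimum of `R` in every ranking, against dominance.
  have hne' : xi ≠ xj := by
    rintro rfl
    obtain ⟨k, hk⟩ := hR xi
    have := hk _ (hmR k)
    by_cases hki : k = i
    · exact absurd (hxj.1 k (hki ▸ hij)) (not_lt.2 this)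
    · exact absurd (hxi.1 k hki) (not_lt.2 this)
  rw [key, ← Set.ncard_pair hne']
  congr 1
  ext x
  simp only [Set.mem_ofPred_eq, Set.mem_insert_iff, Set.mem_singleton_iff]
  constructor
  · rintro (h | h)
    exacts [Or.inl (h.unique hr hxi), Or.inr (h.unique hr hxj)]
  · rintro (rfl | rfl)
    exacts [Or.inl hxi, Or.inr hxj]

omit [Fintype W] in
/-- In a set whose colouring is not onto, the number of points whose removal leaves exactly the
colours different from `i₀` is even. -/
theorem even_card_filter_image_erase (c : W → ι) (i₀ : ι) {S : Finset W}
    (hcard : #S = Fintype.card ι) (hS : S.image c ≠ univ) :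
    Even #{x ∈ S | (S.erase x).image c = univ.erase i₀} := by
  rcases (S.filter fun x => (S.erase x).image c = univ.erase i₀).eq_empty_or_nonempty with h | h
  · simp [h]
  obtain ⟨x₀, hx₀⟩ := h
  obtain ⟨hx₀S, hx₀c⟩ := mem_filter.1 hx₀
  have hcx₀ : c x₀ ≠ i₀ := by
    intro h
    apply hS
    rw [← insert_erase hx₀S, image_insert, hx₀c, h, insert_erase (mem_univ _)]
  have hinj : Set.InjOn c (S.erase x₀ : Finset W) := by
    apply card_image_iff.1
    rw [hx₀c, card_erase_of_mem (mem_univ _), card_erase_of_mem hx₀S, card_univ, hcard]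
  -- One colour occurs twice, at `x₀` and `x₁`; only the removal of one of these two keeps all the
  -- colours.
  obtain ⟨x₁, hx₁, hcx₁⟩ : ∃ x₁ ∈ S.erase x₀, c x₁ = c x₀ := by
    rw [← mem_image, hx₀c]
    exact mem_erase.2 ⟨hcx₀, mem_univ _⟩
  have hne : x₁ ≠ x₀ := (mem_erase.1 hx₁).1
  have hx₁S : x₁ ∈ S := (mem_erase.1 hx₁).2
  have himg : S.image c = univ.erase i₀ := by
    rw [← insert_erase hx₀S, image_insert, hx₀c, insert_eq_self]
    exact mem_erase.2 ⟨hcx₀, mem_univ _⟩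
  have : (S.filter fun x => (S.erase x).image c = univ.erase i₀) = {x₀, x₁} := by
    ext x
    simp only [mem_filter, mem_insert, mem_singleton]
    constructor
    · rintro ⟨hxS, hx⟩
      by_contra! hcon
      have hmem : c x ∈ (S.erase x).image c := by
        rw [hx, ← himg]
        exact mem_image_of_mem c hxS
      obtain ⟨z, hz, hzx⟩ := mem_image.1 hmem
      obtain ⟨hzne, hzS⟩ := mem_erase.1 hz
      by_cases hz0 : z = x₀
      · subst hz0
        exact hcon.2 (hinj (by simp [hxS, hcon.1]) (by simp [hx₁S, hne]) (by rw [hcx₁, hzx]))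
      · exact hzne (hinj (by simp [hzS, hz0]) (by simp [hxS, hcon.1]) hzx)
    · rintro (rfl | rfl)
      · exact ⟨hx₀S, hx₀c⟩
      · refine ⟨hx₁S, ?_⟩
        rw [← himg]
        apply Subset.antisymm (image_subset_image (erase_subset _ _))
        intro i hi
        obtain ⟨z, hz, rfl⟩ := mem_image.1 hi
        by_cases hzx : z = x
        · subst hzx
          exact mem_image.2 ⟨x₀, by simp [hx₀S, hne.symm], hcx₁.symm⟩
        · exact mem_image_of_mem c (mem_erase.2 ⟨hzx, hz⟩)
  rw [this, card_pair hne.symm]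
  exact even_two

/-- **Scarf's lemma**: for a colouring of a finite set with rankings `r i` and slack points `s i`
there is a dominant set carrying every colour exactly once. -/
theorem exists_colorful_isDominant [Nonempty ι] (hr : ∀ i, Function.Injective (r i)) (s : ι → W)
    (hs_min : ∀ i w, r i (s i) ≤ r i w)
    (hs_max : ∀ i j, i ≠ j → ∀ w, w ∉ Set.range s → r i w < r i (s j))
    (hW : ∃ w, w ∉ Set.range s) (c : W → ι) (hc : ∀ i, c (s i) = i) :
    ∃ S : Finset W, #S = Fintype.card ι ∧ S.image c = univ ∧ IsDominant r S := by
  classical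
  have hsinj : Function.Injective s := fun i j h => by rw [← hc i, ← hc j, h]
  obtain ⟨i₀⟩ := ‹Nonempty ι›
  by_contra! hcon
  -- `𝒮` are the rooms, `𝓡` the doors carrying every colour except `i₀`. If no room is colourful,
  -- each has an even number of doors, while every door but `R₀` opens into two rooms and `R₀` into
  -- one.
  set 𝒮 : Finset (Finset W) := univ.filter fun S => #S = Fintype.card ι ∧ IsDominant r S with h𝒮
  set 𝓡 : Finset (Finset W) := univ.filter fun R => #R + 1 = Fintype.card ι ∧
    R.image c = univ.erase i₀ ∧ IsDominant r R with h𝓡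
  have hcount := sum_card_bipartiteAbove_eq_sum_card_bipartiteBelow
    (s := 𝓡) (t := 𝒮) (fun R S => R ⊆ S)
  have hroom : ∀ S ∈ 𝒮, Even #(bipartiteBelow (fun R S : Finset W => R ⊆ S) 𝓡 S) := by
    intro S hS
    obtain ⟨-, hScard, hSdom⟩ := mem_filter.1 hS
    have := even_card_filter_image_erase c i₀ hScard fun h => hcon S hScard h hSdom
    convert this using 1
    symm
    refine card_bij (fun x _ => S.erase x) ?_ ?_ ?_
    · intro x hx
      obtain ⟨hxS, hx⟩ := mem_filter.1 hx
      rw [mem_bipartiteBelow, h𝓡, mem_filter]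
      refine ⟨⟨mem_univ _, ?_, hx, hSdom.mono (erase_subset _ _)⟩, erase_subset _ _⟩
      rw [card_erase_add_one hxS, hScard]
    · intro x hx y hy hxy
      exact (erase_inj S (mem_filter.1 hx).1).1 hxy
    · intro R hR
      rw [mem_bipartiteBelow, h𝓡, mem_filter] at hR
      obtain ⟨⟨-, hRcard, hRc, -⟩, hRS⟩ := hR
      obtain ⟨x, hx⟩ : ∃ x, S \ R = {x} := by
        rw [← card_eq_one, card_sdiff_of_subset hRS]; omega
      have hxm : x ∈ S \ R := hx ▸ mem_singleton_self x
      have hRx : R = S.erase x := by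
        rw [erase_eq, ← hx, Finset.sdiff_sdiff_eq_self hRS]
      exact ⟨x, mem_filter.2 ⟨(mem_sdiff.1 hxm).1, hRx ▸ hRc⟩, hRx.symm⟩
  have hdoor : ∀ R ∈ 𝓡, #(bipartiteAbove (fun R S : Finset W => R ⊆ S) 𝒮 R) =
      ({x | x ∉ R ∧ IsDominant r (insert x R)} : Set W).ncard := by
    intro R hR
    obtain ⟨-, hRcard, hRc, -⟩ := mem_filter.1 hR
    rw [Set.ncard_eq_toFinset_card']
    symm
    refine card_bij (fun x _ => insert x R) ?_ ?_ ?_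
    · intro x hx
      rw [Set.mem_toFinset] at hx
      rw [mem_bipartiteAbove, h𝒮, mem_filter]
      refine ⟨⟨mem_univ _, ?_, hx.2⟩, subset_insert _ _⟩
      rw [card_insert_of_notMem hx.1, hRcard]
    · intro x hx y hy hxy
      rw [Set.mem_toFinset] at hx hy
      exact (insert_inj hx.1).1 hxy
    · intro S hS
      rw [mem_bipartiteAbove, h𝒮, mem_filter] at hS
      obtain ⟨⟨-, hScard, hSdom⟩, hRS⟩ := hS
      obtain ⟨x, hx⟩ : ∃ x, S \ R = {x} := by
        rw [← card_eq_one, card_sdiff_of_subset hRS]; omega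
      have hxm : x ∈ S \ R := hx ▸ mem_singleton_self x
      have hSx : insert x R = S := by
        rw [insert_eq, ← hx, sdiff_union_of_subset hRS]
      refine ⟨x, ?_, hSx⟩
      rw [Set.mem_toFinset]
      exact ⟨(mem_sdiff.1 hxm).2, hSx ▸ hSdom⟩
  have himgs : ∀ t : Finset ι, (t.image s).image c = t := by
    intro t
    rw [image_image, show c ∘ s = id from funext hc, image_id]
  set R₀ : Finset W := (univ.erase i₀).image s with hR₀
  have hR₀mem : R₀ ∈ 𝓡 := by
    rw [h𝓡, mem_filter]
    refine ⟨mem_univ _, ?_, ?_, fun y => ?_⟩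
    · rw [hR₀, card_image_of_injective _ hsinj, card_erase_add_one (mem_univ _), card_univ]
    · rw [hR₀, himgs]
    · by_cases hy : y ∈ Set.range s
      · obtain ⟨j, rfl⟩ := hy
        exact ⟨j, fun x _ => hs_min j x⟩
      · refine ⟨i₀, fun x hx => ?_⟩
        obtain ⟨j, hj, rfl⟩ := mem_image.1 hx
        exact (hs_max i₀ j (ne_of_mem_erase hj).symm y hy).le
  have hR₀one : ({x | x ∉ R₀ ∧ IsDominant r (insert x R₀)} : Set W).ncard = 1 := by
    obtain ⟨t, ht, htmax⟩ := Set.exists_max_image {w | w ∉ Set.range s} (r i₀) (Set.toFinite _) hW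
    rw [Set.ncard_eq_one]
    refine ⟨t, Set.eq_singleton_iff_unique_mem.2 ⟨⟨fun h => ?_, fun y => ?_⟩, ?_⟩⟩
    · obtain ⟨j, -, rfl⟩ := mem_image.1 h
      exact ht ⟨j, rfl⟩
    · by_cases hy : y ∈ Set.range s
      · obtain ⟨j, rfl⟩ := hy
        exact ⟨j, fun x _ => hs_min j x⟩
      · refine ⟨i₀, fun x hx => ?_⟩
        rcases mem_insert.1 hx with rfl | hx
        · exact htmax y hy
        · obtain ⟨j, hj, rfl⟩ := mem_image.1 hx
          exact (hs_max i₀ j (ne_of_mem_erase hj).symm y hy).le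
    · rintro x ⟨hx, hdom⟩
      have hle : ∀ y, y ∉ Set.range s → r i₀ y ≤ r i₀ x := by
        intro y hy
        obtain ⟨i, hi⟩ := hdom y
        by_cases hii : i = i₀
        · exact hii ▸ hi x (mem_insert_self _ _)
        · have h1 := hi (s i) (mem_insert_of_mem
            (mem_image_of_mem s (mem_erase.2 ⟨hii, mem_univ _⟩)))
          exact absurd ⟨i, hr i (le_antisymm (hs_min i y) h1)⟩ hy
      have hxs : x ∉ Set.range s := by
        rintro ⟨j, rfl⟩
        by_cases hj : j = i₀
        · subst hj
          exact ht ⟨j, hr j (le_antisymm (hs_min j t) (hle t ht))⟩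
        · exact hx (mem_image_of_mem s (mem_erase.2 ⟨hj, mem_univ _⟩))
      exact hr i₀ (le_antisymm (htmax x hxs) (hle t ht))
  have htwo : ∀ R ∈ 𝓡.erase R₀,
      Even #(bipartiteAbove (fun R S : Finset W => R ⊆ S) 𝒮 R) := by
    intro R hR
    obtain ⟨hne, hR⟩ := mem_erase.1 hR
    rw [hdoor R hR]
    obtain ⟨-, hRcard, hRc, hRdom⟩ := mem_filter.1 hR
    rw [hRdom.card_extensions hr ?_ hRcard ?_]
    · exact even_two
    · rw [nonempty_iff_ne_empty]
      rintro rfl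
      rw [image_empty] at hRc
      exact hne (by rw [hR₀, ← hRc, image_empty])
    · intro l
      -- If `s l` failed, `R` would consist of all the slack points but `s k`; its colours then
      -- force `k = i₀`, so `R = R₀`.
      refine ⟨s l, fun k hk => ?_⟩
      by_contra! hle
      obtain ⟨w, hw⟩ := hW
      have hsub : R ⊆ (univ.erase k).image s := by
        intro z hz
        have hzs : z ∈ Set.range s := by
          by_contra hzs
          exact absurd (hs_max k l hk z hzs) (not_lt.2 (hle z hz))
        obtain ⟨j, rfl⟩ := hzs
        refine mem_image_of_mem s (mem_erase.2 ⟨?_, mem_univ _⟩)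
        rintro rfl
        exact absurd (hle _ hz) (not_le.2 ((hs_min j w).trans_lt (hs_max j l hk w hw)))
      have heq : R = (univ.erase k).image s := by
        apply eq_of_subset_of_card_le hsub
        rw [card_image_of_injective _ hsinj, card_erase_of_mem (mem_univ _), card_univ]
        omega
      have hki : k = i₀ := by
        rw [heq, himgs] at hRc
        by_contra hki
        have : k ∈ univ.erase i₀ := mem_erase.2 ⟨hki, mem_univ _⟩
        rw [← hRc] at this
        exact notMem_erase _ _ this
      exact hne (by rw [heq, hki])
  rw [← add_sum_erase _ _ hR₀mem, hdoor R₀ hR₀mem, hR₀one] at hcount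
  have h1 := even_sum _ htwo
  have h2 := even_sum _ hroom
  rw [← hcount] at h2
  exact absurd h2 (by rw [Nat.not_even_iff_odd]; exact h1.one_add)

end Scarf

/-! ### From Scarf's lemma to the KKM lemma on the simplex. -/

section Simplex

open Finset

/-- A colouring of the lattice points of a dilated simplex has a lattice point `a` close, for every
index `i`, to the facet `a i = 0` or to a point of colour `i`. -/
theorem exists_lattice_point_near_colors {ι : Type*} [Fintype ι] [Nonempty ι] (m : ℕ)
    (c : (ι → ℕ) → ι) :
    ∃ a : ι → ℕ, ∑ i, a i = m ∧ ∀ i, a i ≤ Fintype.card ι ∨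
      ∃ b : ι → ℕ, ∑ j, b j = m ∧ c b = i ∧
        ∀ j, a j ≤ b j + Fintype.card ι ∧ b j ≤ a j + Fintype.card ι := by
  classical
  let T := {a : ι → ℕ // a ∈ piAntidiag univ m}
  have hT : ∀ a : T, ∑ i, a.1 i = m := fun a => (mem_piAntidiag.1 a.2).1
  have mkT : ∀ a : ι → ℕ, ∑ i, a i = m → a ∈ piAntidiag univ m := fun a h =>
    mem_piAntidiag.2 ⟨h, fun i _ => mem_univ i⟩
  obtain ⟨i₀⟩ := ‹Nonempty ι›
  let t₀ : T := ⟨Pi.single i₀ m, mkT _ (by simp)⟩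
  let _ : Fintype T := inferInstanceAs (Fintype {a // a ∈ piAntidiag univ m})
  let W := T ⊕ ι
  let _ : Fintype W := inferInstanceAs (Fintype (T ⊕ ι))
  let N := Fintype.card W
  let e : W → ℕ := fun w => (Fintype.equivFin W w : ℕ)
  have he : ∀ w, e w < N := fun w => (Fintype.equivFin W w).2
  have heinj : Function.Injective e := Fin.val_injective.comp (Fintype.equivFin W).injective
  -- The shift by 1 puts a slack point strictly below all lattice points in its own ranking, and `m
  -- + 2` puts it above them in the others. Ties are broken by the enumeration `e`.
  let v : ι → W → ℕ := fun i w => Sum.elim (fun a : T => a.1 i + 1)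
    (fun j => if j = i then 0 else m + 2) w
  let r : ι → W → ℕ := fun i w => e w + N * v i w
  have hvr : ∀ i w w', v i w < v i w' → r i w < r i w' := by
    intro i w w' h
    have := Nat.mul_le_mul_left N (Nat.succ_le_of_lt h)
    have := he w
    simp only [r, Nat.mul_succ] at *
    omega
  have hrv : ∀ i w w', r i w ≤ r i w' → v i w ≤ v i w' := fun i w w' h =>
    not_lt.1 fun h' => absurd (hvr i w' w h') (not_lt.2 h)
  have hr : ∀ i, Function.Injective (r i) := by
    intro i w w' h
    have h' := congrArg (· % N) h
    simp only [r, Nat.add_mul_mod_self_left, Nat.mod_eq_of_lt (he _)] at h'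
    exact heinj h'
  have hTm : ∀ (a : T) i, a.1 i ≤ m := fun a i =>
    (single_le_sum (f := a.1) (fun _ _ => Nat.zero_le _) (mem_univ i)).trans (hT a).le
  obtain ⟨S, hScard, hSc, hSdom⟩ := exists_colorful_isDominant (r := r) hr Sum.inr
    (by
      rintro i (a | j)
      · exact (hvr _ _ _ (by simp [v])).le
      · by_cases h : j = i
        · rw [h]
        · exact (hvr _ _ _ (by simp [v, h])).le)
    (by
      rintro i j hij (a | k) hw
      · apply hvr
        have := hTm a i
        simp only [v, Sum.elim_inl, Sum.elim_inr, if_neg hij.symm]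
        omega
      · exact absurd ⟨k, rfl⟩ hw)
    ⟨Sum.inl t₀, by simp⟩ (Sum.elim (fun a : T => c a.1) id) (fun i => rfl)
  let C : Finset ι := univ.filter fun i => Sum.inr i ∉ S
  have hdom : ∀ y : T, ∃ i ∈ C, ∀ x : T, Sum.inl x ∈ S → y.1 i ≤ x.1 i := by
    intro y
    obtain ⟨i, hi⟩ := hSdom (Sum.inl y)
    refine ⟨i, mem_filter.2 ⟨mem_univ _, fun hiS => ?_⟩, fun x hx => ?_⟩
    · have := hrv _ _ _ (hi _ hiS)
      simp [v] at this
    · have := hrv _ _ _ (hi _ hx)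
      simpa [v] using this
  have hcol : ∀ i ∈ C, ∃ x : T, Sum.inl x ∈ S ∧ c x.1 = i := by
    intro i hi
    have : i ∈ S.image (Sum.elim (fun a : T => c a.1) id) := by
      rw [hSc]
      exact mem_univ i
    obtain ⟨(x | j), hx, hxi⟩ := mem_image.1 this
    · exact ⟨x, hx, hxi⟩
    · have : j = i := hxi
      subst this
      exact absurd hx (mem_filter.1 hi).2
  obtain ⟨i₁, hi₁, -⟩ := hdom t₀
  obtain ⟨a, haS, -⟩ := hcol i₁ hi₁
  let S' : Finset T := univ.filter fun x => Sum.inl x ∈ S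
  have hS' : ∀ x, x ∈ S' ↔ Sum.inl x ∈ S := fun x => by simp [S']
  choose μ hμS hμ using fun i => exists_min_image S' (fun x => x.1 i) ⟨a, (hS' a).2 haS⟩
  -- Otherwise some lattice point exceeds the minimum in every coordinate of `C`, with the spare
  -- mass placed at `i₁`, against dominance. So the minima nearly exhaust `m`, which leaves little
  -- room for coordinates to vary.
  have hsum : m < ∑ i ∈ C, ((μ i).1 i + 1) := by
    by_contra! hle
    let y : ι → ℕ := fun i => (if i ∈ C then (μ i).1 i + 1 else 0) +
      (Pi.single i₁ (m - ∑ i ∈ C, ((μ i).1 i + 1)) : ι → ℕ) i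
    have hy : ∑ i, y i = m := by
      simp only [y, sum_add_distrib, sum_pi_single', mem_univ, if_true, sum_ite_mem, univ_inter]
      rw [sum_add_distrib] at hle
      omega
    obtain ⟨i, hi, hiy⟩ := hdom ⟨y, mkT y hy⟩
    have := hiy (μ i) ((hS' _).1 (hμS i))
    simp only [y, if_pos hi] at this
    omega
  have hslack : ∀ x : T, Sum.inl x ∈ S →
      ∀ j, x.1 j ≤ (if j ∈ C then (μ j).1 j else 0) + Fintype.card ι := by
    intro x hx j
    have h1 : ∑ i, (if i ∈ C then (μ i).1 i else 0) + Fintype.card ι > m := by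
      rw [sum_ite_mem, univ_inter]
      rw [sum_add_distrib, ← card_eq_sum_ones] at hsum
      have := card_le_univ C
      omega
    have h2 := hT x
    have h3 : ∑ i ∈ univ.erase j, (if i ∈ C then (μ i).1 i else 0) ≤
        ∑ i ∈ univ.erase j, x.1 i := by
      refine sum_le_sum fun i _ => ?_
      split_ifs
      · exact hμ i x ((hS' x).2 hx)
      · exact Nat.zero_le _
    rw [← add_sum_erase _ _ (mem_univ j)] at h1 h2
    omega
  refine ⟨a.1, hT a, fun i => ?_⟩
  by_cases hi : i ∈ C
  · obtain ⟨b, hbS, hb⟩ := hcol i hi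
    refine Or.inr ⟨b.1, hT b, hb, fun j => ?_⟩
    have ha := hslack a haS j
    have hb := hslack b hbS j
    have ha' := hμ j a ((hS' a).2 haS)
    have hb' := hμ j b ((hS' b).2 hbS)
    split_ifs at ha hb <;> omega
  · have := hslack a haS i
    rw [if_neg hi, zero_add] at this
    exact Or.inl this

open Filter Topology in
/-- If closed sets cover the standard simplex and the `i`-th one contains the facet `x i = 0`,
then they have a common point in the simplex. -/
theorem exists_mem_forall_of_facets_subset {ι : Type*} [Fintype ι] [Nonempty ι]
    (F : ι → Set (ι → ℝ)) (hF : ∀ i, IsClosed (F i))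
    (hfacet : ∀ i, ∀ x ∈ stdSimplex ℝ ι, x i = 0 → x ∈ F i)
    (hcover : ∀ x ∈ stdSimplex ℝ ι, ∃ i, x ∈ F i) :
    ∃ x ∈ stdSimplex ℝ ι, ∀ i, x ∈ F i := by
  classical
  let n : ℝ := Fintype.card ι
  let P : ℕ → (ι → ℕ) → ι → ℝ := fun m a i => (a i : ℝ) / (m + 1)
  have hP : ∀ (m : ℕ) (a : ι → ℕ), ∑ i, a i = m + 1 → P m a ∈ stdSimplex ℝ ι := by
    intro m a ha
    refine ⟨fun i => by positivity, ?_⟩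
    have : (∑ i, (a i : ℝ)) = m + 1 := by exact_mod_cast ha
    rw [← Finset.sum_div, this, div_self (by positivity)]
  have hstep : ∀ m : ℕ, ∃ p ∈ stdSimplex ℝ ι, ∀ i, p i ≤ n / (m + 1) ∨
      ∃ q ∈ F i, dist p q ≤ n / (m + 1) := by
    intro m
    have hc : ∀ a : ι → ℕ, ∃ i, ∑ j, a j = m + 1 → P m a ∈ F i := by
      intro a
      by_cases ha : ∑ j, a j = m + 1
      · obtain ⟨i, hi⟩ := hcover _ (hP m a ha)
        exact ⟨i, fun _ => hi⟩
      · exact ⟨Classical.arbitrary ι, fun h => absurd h ha⟩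
    choose c hc using hc
    obtain ⟨a, ha, hab⟩ := exists_lattice_point_near_colors (m + 1) c
    refine ⟨P m a, hP m a ha, fun i => ?_⟩
    rcases hab i with h | ⟨b, hb, hbi, hclose⟩
    · left
      simp only [P, n]
      gcongr
    · right
      refine ⟨P m b, hbi ▸ hc b hb, ?_⟩
      rw [dist_pi_le_iff (by positivity)]
      intro j
      have h1 : (a j : ℝ) ≤ b j + (Fintype.card ι : ℝ) := by exact_mod_cast (hclose j).1
      have h2 : (b j : ℝ) ≤ a j + (Fintype.card ι : ℝ) := by exact_mod_cast (hclose j).2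
      simp only [P, Real.dist_eq, ← sub_div]
      rw [abs_div, abs_of_pos (by positivity : (0 : ℝ) < m + 1)]
      gcongr
      rw [abs_le]
      constructor <;> simp only [n] <;> linarith
  choose p hpmem hp using hstep
  obtain ⟨x, hx, φ, hφ, hlim⟩ := (isCompact_stdSimplex ℝ ι).tendsto_subseq hpmem
  have hzero : Tendsto (fun k => n / ((φ k : ℝ) + 1)) atTop (𝓝 0) :=
    (tendsto_const_div_atTop_nhds_zero_nat n |>.comp (tendsto_add_atTop_nat 1)
      |>.comp hφ.tendsto_atTop).congr fun k => by simp
  refine ⟨x, hx, fun i => ?_⟩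
  by_contra hxi
  have hpos : 0 < x i := lt_of_le_of_ne (hx.1 i) fun h => hxi (hfacet i x hx h.symm)
  obtain ⟨ε, hε, hball⟩ := Metric.isOpen_iff.1 (hF i).isOpen_compl x hxi
  have e1 : ∀ᶠ k in atTop, dist (p (φ k)) x < min (x i / 2) (ε / 2) :=
    (tendsto_iff_dist_tendsto_zero.1 hlim).eventually_lt_const (by positivity)
  have e2 : ∀ᶠ k in atTop, n / ((φ k : ℝ) + 1) < min (x i / 2) (ε / 2) :=
    hzero.eventually_lt_const (by positivity)
  obtain ⟨k, h1, h2⟩ := (e1.and e2).exists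
  obtain ⟨h1a, h1b⟩ := lt_min_iff.1 h1
  obtain ⟨h2a, h2b⟩ := lt_min_iff.1 h2
  rcases hp (φ k) i with h | ⟨q, hq, hpq⟩
  · have := (dist_le_pi_dist (p (φ k)) x i).trans_lt h1a
    rw [Real.dist_eq, abs_lt] at this
    linarith [this.1]
  · refine hball (Metric.mem_ball.2 ?_) hq
    have := dist_triangle_left q x (p (φ k))
    linarith

/-- **Knaster–Kuratowski–Mazurkiewicz lemma** on the standard simplex. -/
theorem exists_mem_forall_of_kkm {ι : Type*} [Fintype ι] [Nonempty ι]
    (G : ι → Set (ι → ℝ)) (hG : ∀ i, IsClosed (G i))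
    (hcover : ∀ x ∈ stdSimplex ℝ ι, ∃ i, 0 < x i ∧ x ∈ G i) :
    ∃ x ∈ stdSimplex ℝ ι, ∀ i, x ∈ G i := by
  classical
  -- Needed because `Metric.infDist` to the empty set is 0.
  have hne : ∀ i, (G i).Nonempty := by
    intro i
    obtain ⟨j, hj, hjG⟩ := hcover _ (single_mem_stdSimplex ℝ i)
    by_cases h : j = i
    · exact ⟨_, h ▸ hjG⟩
    · simp [h] at hj
  let d : ι → (ι → ℝ) → ℝ := fun i x => Metric.infDist x (G i)
  have hd : ∀ i, Continuous (d i) := fun i => Metric.continuous_infDist_pt _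
  have hd0 : ∀ i x, 0 ≤ d i x := fun i x => Metric.infDist_nonneg
  -- These sets cover: summing the reversed strict inequalities would give ∑ d < ∑ d. At a common
  -- point all the inequalities are equalities, and one index with `d i x = 0 < x i` makes every
  -- distance vanish.
  obtain ⟨x, hx, hxF⟩ := exists_mem_forall_of_facets_subset
    (fun i => {x | x i * ∑ j, d j x ≤ d i x})
    (fun i => isClosed_le (by fun_prop) (hd i))
    (fun i x _ hxi => by simpa [hxi] using hd0 i x)
    (fun x hx => by
      by_contra! h
      have := Finset.sum_lt_sum_of_nonempty univ_nonempty fun i (_ : i ∈ univ) =>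
        show d i x < x i * ∑ j, d j x from not_le.1 (h i)
      rw [← Finset.sum_mul, hx.2, one_mul] at this
      exact lt_irrefl _ this)
  refine ⟨x, hx, ?_⟩
  have heq : ∀ i ∈ univ, x i * ∑ j, d j x = d i x :=
    (Finset.sum_eq_sum_iff_of_le fun i _ => hxF i).1 (by rw [← Finset.sum_mul, hx.2, one_mul])
  obtain ⟨i, hi, hiG⟩ := hcover x hx
  have hdi : d i x = 0 := Metric.infDist_zero_of_mem hiG
  have hsum : ∑ j, d j x = 0 := by
    have := heq i (mem_univ i)
    rw [hdi] at this
    exact (mul_eq_zero.1 this).resolve_left hi.ne'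
  intro j
  rw [(hG j).mem_iff_infDist_zero (hne j)]
  have := heq j (mem_univ j)
  rw [hsum, mul_zero] at this
  exact this.symm

end Simplex

/-! ### Equilibria over self segment-dense sets. -/

section KyFan

open Filter Topology

theorem Finset.sum_equivFin_symm {E M : Type*} [AddCommMonoid M] (t : Finset E) (g : E → M) :
    ∑ i, g (t.equivFin.symm i) = ∑ y ∈ t, g y := by
  rw [t.equivFin.symm.sum_comp fun y : t => g y, Finset.sum_coe_sort]

theorem ConvexOnArbitrary.le_finset_sum {E : Type*} [AddCommGroup E] [Module ℝ E] {S : Set E}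
    {f : E → ℝ} (hf : ConvexOnArbitrary S f) (t : Finset E) (ht : ↑t ⊆ S) (w : E → ℝ)
    (hw : ∀ y ∈ t, 0 ≤ w y) (hw1 : ∑ y ∈ t, w y = 1) (hmem : ∑ y ∈ t, w y • y ∈ S) :
    f (∑ y ∈ t, w y • y) ≤ ∑ y ∈ t, w y * f y := by
  have h := hf t.card (fun i => w (t.equivFin.symm i)) (fun i => (t.equivFin.symm i : E))
    (fun i => hw _ (t.equivFin.symm i).2) ((Finset.sum_equivFin_symm t w).trans hw1) (fun i => ht (t.equivFin.symm i).2)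
  rw [Finset.sum_equivFin_symm t fun y => w y • y,
    Finset.sum_equivFin_symm t fun y => w y * f y] at h
  exact h hmem

variable {E : Type*} [AddCommGroup E] [Module ℝ E] [TopologicalSpace E] [ContinuousAdd E]
  [ContinuousSMul ℝ E]

/-- Segment density spreads to polytopes by induction on the vertices: a point of the hull lies on a
segment from the new vertex to the old hull. The far endpoint is first approximated within `U`, then
the point on the resulting segment. -/
theorem SelfSegmentDense.convexHull_subset_closure {U V : Set E} (hU : SelfSegmentDense U V)
    (t : Finset E) (ht : ↑t ⊆ U) :
    convexHull ℝ (t : Set E) ⊆ closure (convexHull ℝ (t : Set E) ∩ U) := by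
  classical
  induction t using Finset.induction_on with
  | empty => simp
  | insert a s _ ih =>
    rw [Finset.coe_insert] at ht ⊢
    have haU : a ∈ U := ht (Set.mem_insert _ _)
    rcases s.eq_empty_or_nonempty with rfl | hs
    · simpa using subset_closure (show a ∈ {a} ∩ U from ⟨rfl, haU⟩)
    · intro z hz
      rw [convexHull_insert (by simpa using hs)] at hz
      obtain ⟨b, hb, w, hw, hzw⟩ := mem_convexJoin.1 hz
      obtain rfl : b = a := hb
      obtain ⟨α, β, hα, hβ, hαβ, rfl⟩ := hzw
      rw [← closure_closure]
      refine map_mem_closure (f := fun w => α • b + β • w) (by fun_prop)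
        (ih ((Set.subset_insert _ _).trans ht) hw) fun w' hw' => ?_
      have hseg : segment ℝ b w' ⊆ convexHull ℝ (insert b (s : Set E)) :=
        (convex_convexHull ℝ _).segment_subset (subset_convexHull ℝ _ (Set.mem_insert _ _))
          (convexHull_mono (Set.subset_insert _ _) hw'.1)
      exact closure_mono (Set.inter_subset_inter_left _ hseg)
        (hU.2.2 b haU w' hw'.2 ⟨α, β, hα, hβ, hαβ, rfl⟩)

variable {K U : Set E} {f : E → E → ℝ}

/-- A Ky Fan type equilibrium statement on the convex hull of finitely many points of a self
segment-dense set. -/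
theorem SelfSegmentDense.exists_forall_finset_nonneg (hU : SelfSegmentDense U K)
    (hK : Convex ℝ K) (husc : ∀ y ∈ U, UpperSemicontinuousOn (fun x => f x y) K)
    (hconv : ∀ x ∈ K, ConvexOnArbitrary U (f x)) (hdiag : ∀ x ∈ U, 0 ≤ f x x)
    (t : Finset E) (ht : ↑t ⊆ U) (hne : t.Nonempty) :
    ∃ x ∈ convexHull ℝ (t : Set E), ∀ y ∈ t, 0 ≤ f x y := by
  classical
  have : Nonempty t := hne.to_subtype
  have htK : ∀ s : Finset E, s ⊆ t → convexHull ℝ (s : Set E) ⊆ K := fun s hs =>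
    convexHull_min ((Finset.coe_subset.2 hs).trans (ht.trans hU.1)) hK
  let b : (t → ℝ) → E := fun w => ∑ i, w i • (i : E)
  have hb : Continuous b := by fun_prop
  have hbt : ∀ w ∈ stdSimplex ℝ t, b w ∈ convexHull ℝ (t : Set E) := fun w hw =>
    (convex_convexHull ℝ _).sum_mem (fun i _ => hw.1 i) hw.2
      fun i _ => subset_convexHull ℝ _ i.2
  choose v hvc hv using fun i : t =>
    upperSemicontinuousOn_iff_preimage_Ici.1 (husc i (ht i.2)) 0
  have hmem : ∀ x ∈ K, ∀ i : t, x ∈ v i ↔ 0 ≤ f x i := by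
    intro x hx i
    have := Set.ext_iff.1 (hv i) x
    simpa [hx] using this.symm
  suffices hkkm : ∀ w ∈ stdSimplex ℝ t, ∃ i, 0 < w i ∧ b w ∈ v i by
    obtain ⟨w, hw, hwG⟩ := exists_mem_forall_of_kkm (fun i : t => b ⁻¹' v i)
      (fun i => (hvc i).preimage hb) hkkm
    exact ⟨b w, hbt w hw, fun y hy =>
      (hmem _ (htK t subset_rfl (hbt w hw)) ⟨y, hy⟩).1 (hwG ⟨y, hy⟩)⟩
  intro w hw
  by_contra! hcon
  let J : Finset t := Finset.univ.filter fun i => 0 < w i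
  let s : Finset E := J.image Subtype.val
  have hst : s ⊆ t := by
    intro y hy
    obtain ⟨i, -, rfl⟩ := Finset.mem_image.1 hy
    exact i.2
  have hJ : ∀ i, i ∉ J → w i = 0 := by
    intro i hi
    by_contra hne
    exact hi (Finset.mem_filter.2 ⟨Finset.mem_univ _, lt_of_le_of_ne (hw.1 i) (Ne.symm hne)⟩)
  have hbs : b w ∈ convexHull ℝ (s : Set E) := by
    change ∑ i, w i • (i : E) ∈ _
    rw [← Finset.sum_subset (Finset.subset_univ J) fun i _ hi => by rw [hJ i hi, zero_smul]]
    exact (convex_convexHull ℝ _).sum_mem (fun i _ => hw.1 i)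
      ((Finset.sum_subset (Finset.subset_univ J) fun i _ hi => hJ i hi).trans hw.2)
      fun i hi => subset_convexHull ℝ _ (Finset.mem_coe.2 (Finset.mem_image_of_mem _ hi))
  -- The sets `v i` are closed in the whole space, so avoiding them is an open condition.
  have hev : ∀ᶠ x in 𝓝 (b w), ∀ i ∈ J, x ∉ v i := by
    rw [Filter.eventually_all_finset]
    exact fun i hi => (hvc i).isOpen_compl.mem_nhds (hcon i (Finset.mem_filter.1 hi).2)
  have hfreq := mem_closure_iff_frequently.1
    (hU.convexHull_subset_closure s ((Finset.coe_subset.2 hst).trans ht) hbs)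
  obtain ⟨x, ⟨hxs, hxU⟩, hxv⟩ := (hfreq.and_eventually hev).exists
  have hneg : ∀ y ∈ s, f x y < 0 := by
    intro y hy
    obtain ⟨i, hi, rfl⟩ := Finset.mem_image.1 hy
    exact not_le.1 fun h => hxv i hi ((hmem x (hU.1 hxU) i).2 h)
  obtain ⟨l, hl0, hl1, hlx⟩ := Finset.mem_convexHull'.1 hxs
  have hle := (hconv x (hU.1 hxU)).le_finset_sum s ((Finset.coe_subset.2 hst).trans ht) l hl0 hl1
    (hlx ▸ hxU)
  rw [hlx] at hle
  obtain ⟨y, hy, hly⟩ : ∃ y ∈ s, 0 < l y := by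
    by_contra! h
    have := Finset.sum_nonpos h
    linarith
  have : ∑ y ∈ s, l y * f x y < 0 :=
    Finset.sum_neg' (fun z hz => mul_nonpos_of_nonneg_of_nonpos (hl0 z hz) (hneg z hz).le)
      ⟨y, hy, mul_neg_of_pos_of_neg hly (hneg y hy)⟩
  linarith [hdiag x hxU]

/-- The equilibrium problem restricted to a compact convex part of the domain. -/
theorem SelfSegmentDense.exists_forall_inter_nonneg (hU : SelfSegmentDense U K)
    (hK : Convex ℝ K) (husc : ∀ y ∈ U, UpperSemicontinuousOn (fun x => f x y) K)
    (hconv : ∀ x ∈ K, ConvexOnArbitrary U (f x)) (hdiag : ∀ x ∈ U, 0 ≤ f x x)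
    {C : Set E} (hCK : C ⊆ K) (hC : Convex ℝ C) (hCc : IsCompact C) (hCne : C.Nonempty) :
    ∃ x ∈ C, ∀ y ∈ U ∩ C, 0 ≤ f x y := by
  classical
  choose v hvc hv using fun y : ↥(U ∩ C) =>
    upperSemicontinuousOn_iff_preimage_Ici.1 (husc y y.2.1) 0
  have hmem : ∀ x ∈ K, ∀ y : ↥(U ∩ C), x ∈ v y ↔ 0 ≤ f x y := by
    intro x hx y
    have := Set.ext_iff.1 (hv y) x
    simpa [hx] using this.symm
  obtain ⟨x, hxC, hx⟩ := hCc.inter_iInter_nonempty v hvc fun u => by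
    rcases u.eq_empty_or_nonempty with rfl | hu
    · simpa using hCne
    have hsub : ∀ y ∈ u.image Subtype.val, y ∈ U ∩ C := by
      intro y hy
      obtain ⟨i, -, rfl⟩ := Finset.mem_image.1 hy
      exact i.2
    obtain ⟨x, hx, hxu⟩ := hU.exists_forall_finset_nonneg hK husc hconv hdiag
      (u.image Subtype.val) (fun y hy => (hsub y hy).1) (hu.image _)
    have hxC : x ∈ C := convexHull_min (fun y hy => (hsub y hy).2) hC hx
    refine ⟨x, hxC, Set.mem_iInter₂.2 fun y hy => (hmem x (hCK hxC) y).2 ?_⟩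
    exact hxu y (Finset.mem_image_of_mem _ hy)
  exact ⟨x, hxC, fun y hy => (hmem x (hCK hxC) ⟨y, hy⟩).1 (Set.mem_iInter.1 hx ⟨y, hy⟩)⟩

end KyFan

/-! ### Weak compactness and weakly dense segments. -/

section Weak

open Filter Topology

variable {X : Type*} [NormedAddCommGroup X] [NormedSpace ℝ X]

/-- Boundedness and surjectivity onto the bidual make the weak closure compact; by convexity the
weak closure is the norm closure. -/
theorem IsReflexiveSpace.isCompact_toWeakSpace_image (hX : IsReflexiveSpace X) {S : Set X}
    (hconv : Convex ℝ S) (hclosed : IsClosed S) (hb : Bornology.IsBounded S) :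
    IsCompact (toWeakSpace ℝ X '' S) := by
  have h := NormedSpace.isCompact_closure_of_isBounded ℝ X (toWeakSpace ℝ X '' S)
    (by rwa [Set.preimage_image_eq _ (toWeakSpace ℝ X).injective]) (by
      intro z _
      obtain ⟨x, hx⟩ := hX (WeakDual.toStrongDual z)
      exact ⟨toWeakSpace ℝ X x, by
        apply WeakDual.toStrongDual.injective
        rw [← hx]
        rfl⟩)
  rwa [← hconv.toWeakSpace_closure (𝕜 := ℝ), hclosed.closure_eq] at h

/-- Arbitrarily close to the endpoint `a` there are points of a weakly self segment-dense set in
the half-open segment from `a` to `b`. -/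
theorem WeaklySelfSegmentDense.exists_lineMap_mem {D K : Set X} (hD : WeaklySelfSegmentDense D K)
    {a b : X} (ha : a ∈ D) (hb : b ∈ D) (hab : a ≠ b) {δ : ℝ} (hδ : 0 < δ) :
    ∃ s : ℝ, 0 < s ∧ s < δ ∧ s ≤ 1 ∧ a + s • (b - a) ∈ D := by
  -- Since `g (b - a) = 1`, `g` reads off the parameter along the segment, so `0 < s < δ` becomes a
  -- weakly open condition.
  obtain ⟨g, hg⟩ := SeparatingDual.exists_eq_one (R := ℝ) (sub_ne_zero.2 hab.symm)
  let e := toWeakSpace ℝ X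
  have hgc : Continuous fun z : WeakSpace ℝ X => g (e.symm z) :=
    WeakBilin.eval_continuous (topDualPairing ℝ X).flip g
  set τ : ℝ := min (δ / 2) 1 with hτ
  have hτ0 : 0 < τ := by positivity
  have hgs : ∀ s : ℝ, g (a + s • (b - a)) = g a + s := by
    intro s
    rw [map_add, map_smul, hg, smul_eq_mul, mul_one]
  have hp : e a + τ • (e b - e a) ∈ segment ℝ (e a) (e b) := by
    rw [segment_eq_image']
    exact ⟨τ, ⟨hτ0.le, min_le_right _ _⟩, rfl⟩
  have hcl := hD.2.2 (e a) ⟨a, ha, rfl⟩ (e b) ⟨b, hb, rfl⟩ hp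
  have hopen : IsOpen {z : WeakSpace ℝ X | g a < g (e.symm z) ∧ g (e.symm z) < g a + δ} :=
    (isOpen_lt continuous_const hgc).inter (isOpen_lt hgc continuous_const)
  have hsymm : ∀ s : ℝ, e.symm (e a + s • (e b - e a)) = a + s • (b - a) := by
    intro s
    simp
  obtain ⟨z, ⟨hz1, hz2⟩, hzseg, d, hd, rfl⟩ := mem_closure_iff.1 hcl _ hopen (by
    change g a < _ ∧ _ < _
    rw [hsymm, hgs]
    have : τ ≤ δ / 2 := min_le_left _ _
    constructor <;> linarith)
  rw [segment_eq_image'] at hzseg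
  obtain ⟨s, hs, hsd⟩ := hzseg
  have hds : d = a + s • (b - a) := by
    rw [← hsymm s]
    exact (e.symm_apply_eq.2 hsd).symm
  change g a < g (e.symm (e d)) at hz1
  change g (e.symm (e d)) < _ at hz2
  rw [e.symm_apply_apply, hds, hgs] at hz1 hz2
  exact ⟨s, by linarith, by linarith, hs.2, hds ▸ hd⟩

theorem exists_norm_add_smul_lt {a : X} {r : ℝ} (ha : ‖a‖ < r) (v : X) :
    ∃ δ : ℝ, 0 < δ ∧ ∀ s : ℝ, 0 < s → s < δ → ‖a + s • v‖ ≤ r := by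
  have hc : ContinuousAt (fun s : ℝ => ‖a + s • v‖) 0 := by fun_prop
  have hev : ∀ᶠ s : ℝ in 𝓝 0, ‖a + s • v‖ < r :=
    hc.eventually_lt_const (by simpa using ha)
  obtain ⟨δ, hδ, h⟩ := Metric.eventually_nhds_iff.1 hev
  refine ⟨δ, hδ, fun s hs hsδ => (h ?_).le⟩
  rwa [Real.dist_eq, sub_zero, abs_of_pos hs]

end Weak

/-! ### The equilibrium theorem: from the ball to `D`, then to `K`. -/

theorem theorem4p7 {X : Type*} [NormedAddCommGroup X] [NormedSpace ℝ X] [CompleteSpace X]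
    (hX : IsReflexiveSpace X)
    (K D : Set X) (hKne : K.Nonempty) (hKconv : Convex ℝ K) (hKclosed : IsClosed K)
    (hD : WeaklySelfSegmentDense D K)
    (φ : X → X → ℝ)
    (hi : ∀ y ∈ D, ∀ x ∈ K, WeaklyUSCWithinAt (fun x' => φ x' y) K x)
    (hii : ∀ x ∈ K, ∀ y ∈ K \ D, WeaklyUSCWithinAt (fun y' => φ x y') K y)
    (hiii : ∀ x ∈ K, ConvexOnArbitrary D (fun y => φ x y))
    (hiv : ∀ x ∈ D, 0 ≤ φ x x)
    (hv : ∃ r : ℝ, 0 < r ∧ (∃ x ∈ K, ‖x‖ ≤ r) ∧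
      ∀ x ∈ K, ‖x‖ ≤ r → ∃ y₀ ∈ D, ‖y₀‖ < r ∧ φ x y₀ = 0) :
    ∃ x₀ ∈ K, ∀ y ∈ K, 0 ≤ φ x₀ y := by
  obtain ⟨r, -, ⟨p, hpK, hpr⟩, hv⟩ := hv
  let e := toWeakSpace ℝ X
  have hDK : D ⊆ K := by
    intro y hy
    obtain ⟨z, hz, hzy⟩ := hD.1 ⟨y, hy, rfl⟩
    exact (toWeakSpace ℝ X).injective hzy ▸ hz
  have hBconv : Convex ℝ (K ∩ Metric.closedBall 0 r) := hKconv.inter (convex_closedBall 0 r)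
  obtain ⟨x', ⟨x, ⟨hxK, hxr⟩, rfl⟩, hx⟩ := SelfSegmentDense.exists_forall_inter_nonneg
    (f := fun a b => φ (e.symm a) (e.symm b)) (C := e '' (K ∩ Metric.closedBall 0 r)) hD
    (hKconv.linear_image e.toLinearMap) (by
      rintro _ ⟨y, hy, rfl⟩ _ ⟨x, hx, rfl⟩
      change UpperSemicontinuousWithinAt (fun z => φ (e.symm z) (e.symm (e y))) _ _
      rw [e.symm_apply_apply]
      exact hi y hy x hx) (by
      rintro _ ⟨x, hx, rfl⟩ n w z hw hw1 hz hmem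
      have h := hiii x hx n w (fun i => e.symm (z i)) hw hw1
        (fun i => by
          obtain ⟨d, hd, hdz⟩ := hz i
          rw [← hdz]
          simpa [e] using hd)
        (by
          obtain ⟨d, hd, hdz⟩ := hmem
          have : ∑ i, w i • e.symm (z i) = d := by
            rw [e.eq_symm_apply.2 hdz, map_sum]
            simp
          rwa [this])
      simpa [e, map_sum] using h) (by
      rintro _ ⟨x, hx, rfl⟩
      simpa [e] using hiv x hx)
    (Set.image_mono Set.inter_subset_left) (hBconv.linear_image e.toLinearMap)
    (hX.isCompact_toWeakSpace_image hBconv (hKclosed.inter Metric.isClosed_closedBall)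
      (Metric.isBounded_closedBall.subset Set.inter_subset_right))
    ⟨e p, p, ⟨hpK, by simpa using hpr⟩, rfl⟩
  have hxr' : ‖x‖ ≤ r := by simpa using hxr
  have hball : ∀ y ∈ D, ‖y‖ ≤ r → 0 ≤ φ x y := by
    intro y hy hyr
    simpa using hx (e y) ⟨⟨y, hy, rfl⟩, y, ⟨hDK hy, by simpa using hyr⟩, rfl⟩
  obtain ⟨y₀, hy₀, hy₀r, hφ⟩ := hv x hxK hxr'
  have hDnonneg : ∀ y ∈ D, 0 ≤ φ x y := by
    intro y hy
    by_cases hyy : y₀ = y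
    · rw [← hyy, hφ]
    -- The strict bound on `‖y₀‖` leaves room to move towards `y` inside the ball. As `φ x y₀ = 0`,
    -- convexity gives `0 ≤ s * φ x y` with `s > 0`.
    obtain ⟨δ, hδ, hδr⟩ := exists_norm_add_smul_lt hy₀r (y - y₀)
    obtain ⟨s, hs0, hsδ, hs1, hsD⟩ := hD.exists_lineMap_mem hy₀ hy hyy hδ
    have heq : y₀ + s • (y - y₀) = (1 - s) • y₀ + s • y := by module
    have hnn := hball _ hsD (hδr s hs0 hsδ)
    have hle := hiii x hxK 2 ![1 - s, s] ![y₀, y]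
      (by simpa [Fin.forall_fin_two] using ⟨hs1, hs0.le⟩) (by simp)
      (by simpa [Fin.forall_fin_two] using ⟨hy₀, hy⟩)
      (by simpa [Fin.sum_univ_two, ← heq] using hsD)
    simp only [Fin.sum_univ_two, Matrix.cons_val_zero, Matrix.cons_val_one, hφ, ← heq] at hle
    have : 0 ≤ s * φ x y := by linarith
    exact nonneg_of_mul_nonneg_right this hs0
  refine ⟨x, hxK, fun y hy => ?_⟩
  by_cases hyD : y ∈ D
  · exact hDnonneg y hyD
  by_contra! hneg
  -- A negative value at `y` would persist weakly nearby in `K`, hence at some point of `D`.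
  have hev := hii x hxK y ⟨hy, hyD⟩ 0 (by simpa using hneg)
  rw [eventually_nhdsWithin_iff] at hev
  have hfreq := mem_closure_iff_frequently.1 (hD.2.1 ⟨y, hy, rfl⟩)
  obtain ⟨_, ⟨d, hd, rfl⟩, h⟩ := (hfreq.and_eventually hev).exists
  have := h ⟨d, hDK hd, rfl⟩
  change φ x ((toWeakSpace ℝ X).symm (toWeakSpace ℝ X d)) < 0 at this
  rw [LinearEquiv.symm_apply_apply] at this
  exact absurd (hDnonneg d hd) (not_le.2 this)
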